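/- Let $\mathbb{F}_q$ be a finite field with $q$ elements, $q$ odd, and let $A=\mathbb{F}_q[T]$. For $a\in A$ and an irreducible $\varpi\in A$ define the Legendre symbol $\left(\frac{a}{\varpi}\right)$ to be $0$ if $\varpi\mid a$, $1$ if $\varpi\nmid a$ and $a$ is a square modulo $\varpi$, and $-1$ if $a$ is not a square modulo $\varpi$. Let $l\ge 2$ be an even integer, let $\varpi_1,\dots,\varpi_l\in A$ be pairwise distinct monic irreducible polynomials, and set $r:=\prod_{i=1}^{l}\varpi_i$. Then there exists a monic irreducible polynomial $\alpha\in A$ of even degree such that $$\left(\frac{\alpha}{\varpi_i}\right)=-1\quad\text{for all } i=1,\dots,l.$$ Moreover, every monic irreducible polynomial $\alpha\in A$ of even degree with this property satisfies $\left(\frac{r}{\alpha}\right)=1$. -/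

import Mathlib

open Classical in
/-- The Legendre symbol of `a` at `ϖ` in the polynomial ring `F[T]` (for `ϖ` irreducible):
`0` if `ϖ` divides `a`, `1` if `a` is not divisible by `ϖ` and is a square modulo `ϖ`,
and `-1` if `a` is a non-square modulo `ϖ`. -/
noncomputable def polyLegendre {F : Type*} [Field F] (a ϖ : Polynomial F) : ℤ :=
  if ϖ ∣ a then 0
  else if IsSquare (Ideal.Quotient.mk (Ideal.span {ϖ}) a) then 1
  else -1

/-!
Two classical facts about `A = F[X]` carry the theorem: quadratic reciprocity, and enough of
Dirichlet's theorem on primes in progressions to handle quadratic characters.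

*Reciprocity.* The Legendre symbol `(f / P)` is the quadratic character of the residue field
`A / (P)`, hence by Euler's criterion the quadratic character of `F` at the norm of `f`, and this
norm is the resultant of `P` and `f` (`polyLegendre_eq_quadraticChar_resultant`). Resultants are
symmetric up to the sign `(-1) ^ (deg P * deg Q)`, so `(α / ϖ) = (ϖ / α)` when `α` has even degree
(`polyLegendre_comm_of_even`). The symbol of `∏ ϖ i` at `α` is therefore `(-1) ^ l = 1`.

*Existence.* For a set `s` of indices let `χ` be the product of the Legendre symbols at `ϖ i` with
`i ∈ s`, let `L(u)` be the generating function of the sums of `χ` over monic polynomials of a given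
degree, and let `c n` be the coefficients of `u L' / L`, which are the sums of `Λ χ`
(`natCast_mul_lCoeff`). For the trivial character `c n = q ^ n` for `n ≥ 1`
(`sum_natDegree_primePowersOfDegree`), so `|c n| ≤ q ^ n` in general. For nonempty `s`, `L` is a
polynomial by orthogonality (`lCoeff_eq_zero`). It does not vanish at `u = ± 1 / q`: a zero there
would make `L(u) / (1 ∓ q u)` a polynomial, while after substituting `± u` for `u` the coefficients
of its logarithmic derivative are `q ^ n + (± 1) ^ n * c n ≥ 0`, positive for every even `n ≥ 2`
(`eval_one_ne_zero_of_logDeriv_coeff`, applied after rescaling `u` by `q`). Hence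
`u L' / L` is bounded as `u` tends to `± 1 / q` along the real axis, and so is its even part
(`eventually_abs_evenLogDeriv_le`).

Now expand `∏ (1 - χ i)` over all sets `s`. The trivial character contributes a pole to the even
part at `u = 1 / q` (`tendsto_evenLogDeriv_one`) and the others stay bounded. If no monic
irreducible polynomial of even degree were a non-residue at every `ϖ i`, then in large even degree only proper
prime powers could contribute to the sum of `Λ ∏ (1 - χ i)`, and those are of size
`O(n ^ 2 q ^ (n / 2))`, too few for a pole (`abs_sum_prod_one_sub_polyLegendre_le`).
-/

open Polynomial Filter Topology

/-! ### Nonvanishing from the logarithmic derivative -/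

/-- Let `c` be the coefficient sequence of `X L' / L`. If `L` vanished at `1`, then
`W = L / (1 - X)` would be a polynomial whose logarithmic derivative has coefficients `c n + 1 ≥ 0` for
`n ≥ 1`. Then `W` has nonnegative coefficients, infinitely many of them positive, which is absurd. -/
theorem eval_one_ne_zero_of_logDeriv_coeff {L : ℝ[X]} {c : ℕ → ℝ} (hL : L.coeff 0 = 1)
    (hc0 : c 0 = 0) (hc : ∀ n, -1 ≤ c n) (hinf : ∀ N, ∃ n ≥ N, -1 < c n)
    (h : ∀ n, n * L.coeff n = ∑ p ∈ Finset.HasAntidiagonal.antidiagonal n, c p.1 * L.coeff p.2) :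
    L.eval 1 ≠ 0 := by
  intro h1
  obtain ⟨V, hV⟩ := dvd_iff_isRoot.mpr h1
  obtain ⟨W, hW⟩ : ∃ W : ℝ[X], L = (1 - X) * W := ⟨-V, by rw [hV]; simp only [C_1]; ring⟩
  set d : ℕ → ℝ := fun n => if n = 0 then 0 else c n + 1 with hd
  have hd0 : ∀ n, 0 ≤ d n := by
    intro n
    simp only [hd]
    split_ifs
    · exact le_rfl
    · linarith [hc n]
  have hW0 : W.coeff 0 = 1 := by
    rw [hW, mul_coeff_zero] at hL
    simpa using hL
  -- the logarithmic derivative of `W = L / (1 - X)` has the coefficients `d n`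
  have key : ∀ n, n * W.coeff n = ∑ p ∈ Finset.HasAntidiagonal.antidiagonal n,
      d p.1 * W.coeff p.2 := by
    have hone : (1 - PowerSeries.X) * PowerSeries.mk (fun _ => (1 : ℝ)) = 1 := by
      rw [mul_comm]; exact PowerSeries.mk_one_mul_one_sub_eq_one ℝ
    have hXder : ∀ Q : ℝ[X], PowerSeries.mk (fun n => (n : ℝ) * Q.coeff n)
        = ((X * derivative Q : ℝ[X]) : PowerSeries ℝ) := by
      intro Q
      ext n
      rw [PowerSeries.coeff_mk, coeff_coe]
      cases n with
      | zero => simp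
      | succ n => rw [coeff_X_mul, coeff_derivative]; push_cast; ring
    have hC : PowerSeries.mk (fun n => (n : ℝ) * L.coeff n)
        = PowerSeries.mk c * (L : PowerSeries ℝ) := by
      ext n
      rw [PowerSeries.coeff_mk, PowerSeries.coeff_mul, h]
      simp
    have hD : PowerSeries.mk d
        = PowerSeries.mk c + PowerSeries.X * PowerSeries.mk (fun _ => (1 : ℝ)) := by
      ext n
      cases n with
      | zero => simp [hd, hc0]
      | succ n => simp [hd, PowerSeries.coeff_succ_X_mul]
    have hmain : PowerSeries.mk (fun n => (n : ℝ) * W.coeff n)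
        = PowerSeries.mk d * (W : PowerSeries ℝ) := by
      rw [hXder] at hC ⊢
      rw [hD]
      rw [hW] at hC
      simp only [derivative_mul, derivative_sub, derivative_one, derivative_X, coe_mul, coe_add,
        coe_sub, coe_one, coe_X, coe_zero] at hC ⊢
      generalize PowerSeries.mk c = cc at *
      generalize PowerSeries.mk (fun _ => (1 : ℝ)) = G at *
      generalize (W : PowerSeries ℝ) = w at *
      generalize ((derivative W : ℝ[X]) : PowerSeries ℝ) = w' at *
      generalize (PowerSeries.X : PowerSeries ℝ) = x at *
      linear_combination G * hC + (cc * w - x * w') * hone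
    intro n
    have := congrArg (PowerSeries.coeff n) hmain
    rw [PowerSeries.coeff_mk, PowerSeries.coeff_mul] at this
    simpa using this
  have hWnn : ∀ n, 0 ≤ W.coeff n := by
    intro n
    induction n using Nat.strong_induction_on with
    | _ n ih =>
      rcases Nat.eq_zero_or_pos n with rfl | hn
      · rw [hW0]; exact zero_le_one
      · have : 0 ≤ (n : ℝ) * W.coeff n := by
          rw [key]
          refine Finset.sum_nonneg fun p hp => ?_
          rcases Nat.eq_zero_or_pos p.1 with h0 | h0
          · simp [h0, hd]
          · rw [Finset.HasAntidiagonal.mem_antidiagonal] at hp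
            exact mul_nonneg (hd0 _) (ih _ (by omega))
        exact nonneg_of_mul_nonneg_right this (by exact_mod_cast hn)
  obtain ⟨n, hn, hcn⟩ := hinf (W.natDegree + 1)
  have hdn : 0 < d n := by
    simp only [hd]
    rw [if_neg (by omega)]
    linarith
  have h2 : d n * W.coeff 0 ≤ n * W.coeff n := by
    rw [key]
    exact Finset.single_le_sum (f := fun p : ℕ × ℕ => d p.1 * W.coeff p.2)
      (a := (n, 0)) (fun p _ => mul_nonneg (hd0 _) (hWnn _))
      (Finset.HasAntidiagonal.mem_antidiagonal.mpr (add_zero n))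
  rw [hW0, coeff_eq_zero_of_natDegree_lt (by omega)] at h2
  linarith

theorem summable_mul_pow_of_abs_le_one {c : ℕ → ℝ} (hc : ∀ n, |c n| ≤ 1) {x : ℝ} (hx : |x| < 1) :
    Summable fun n => ‖c n * x ^ n‖ := by
  refine Summable.of_nonneg_of_le (fun _ => norm_nonneg _) (fun n => ?_)
    (summable_geometric_of_lt_one (abs_nonneg x) hx)
  rw [Real.norm_eq_abs, abs_mul, abs_pow]
  exact mul_le_of_le_one_left (by positivity) (hc n)

/-- As `L` does not vanish at `1`, the series of `X L' / L` stays bounded at the boundary point `1`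
of its disc of convergence. -/
theorem eventually_abs_tsum_le_of_logDeriv_coeff {L : ℝ[X]} {c : ℕ → ℝ} (hL : L.coeff 0 = 1)
    (hc0 : c 0 = 0) (hc : ∀ n, |c n| ≤ 1) (hinf : ∀ N, ∃ n ≥ N, -1 < c n)
    (h : ∀ n, n * L.coeff n = ∑ p ∈ Finset.HasAntidiagonal.antidiagonal n, c p.1 * L.coeff p.2) :
    ∃ B : ℝ, ∀ᶠ x in 𝓝[<] (1 : ℝ), |∑' n, c n * x ^ n| ≤ B := by
  have hL1 := eval_one_ne_zero_of_logDeriv_coeff hL hc0 (fun n => (abs_le.mp (hc n)).1) hinf h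
  have hmul : ∀ x : ℝ, |x| < 1 → (∑' n, c n * x ^ n) * L.eval x = x * L.derivative.eval x := by
    intro x hx
    have hfin : ∀ (Q : ℝ[X]), HasSum (fun n => Q.coeff n * x ^ n) (Q.eval x) := by
      intro Q
      rw [eval_eq_sum_range]
      refine hasSum_sum_of_ne_finset_zero fun n hn => ?_
      rw [coeff_eq_zero_of_natDegree_lt (by simpa using hn), zero_mul]
    have hLs : Summable fun n => ‖L.coeff n * x ^ n‖ := (hfin L).summable.norm
    rw [← (hfin L).tsum_eq,
      tsum_mul_tsum_eq_tsum_sum_antidiagonal_of_summable_norm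
        (summable_mul_pow_of_abs_le_one hc hx) hLs]
    have h2 := hfin (X * derivative L)
    rw [eval_mul, eval_X] at h2
    rw [← h2.tsum_eq]
    refine tsum_congr fun n => ?_
    have h3 : (X * derivative L).coeff n = n * L.coeff n := by
      cases n with
      | zero => simp
      | succ n => rw [coeff_X_mul, coeff_derivative]; push_cast; ring
    rw [h3, h, Finset.sum_mul]
    refine Finset.sum_congr rfl fun p hp => ?_
    rw [← Finset.HasAntidiagonal.mem_antidiagonal.mp hp, pow_add]
    ring
  have htend : Tendsto (fun x : ℝ => x * L.derivative.eval x / L.eval x) (𝓝[<] 1)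
      (𝓝 (1 * L.derivative.eval 1 / L.eval 1)) := by
    refine Tendsto.mono_left ?_ nhdsWithin_le_nhds
    exact ((continuous_id.mul L.derivative.continuous).tendsto 1).div (L.continuous.tendsto 1) hL1
  have hev : ∀ᶠ x in 𝓝[<] (1 : ℝ),
      ∑' n, c n * x ^ n = x * L.derivative.eval x / L.eval x := by
    have h4 : ∀ᶠ x in 𝓝[<] (1 : ℝ), L.eval x ≠ 0 :=
      ((L.continuous.tendsto 1).eventually_ne hL1).filter_mono nhdsWithin_le_nhds
    have h5 : ∀ᶠ x in 𝓝[<] (1 : ℝ), x ∈ Set.Ioo (0 : ℝ) 1 := Ioo_mem_nhdsLT zero_lt_one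
    filter_upwards [h4, h5] with x hx hx1
    rw [eq_div_iff hx]
    exact hmul x (abs_lt.mpr ⟨by linarith [hx1.1], hx1.2⟩)
  refine ⟨|1 * L.derivative.eval 1 / L.eval 1| + 1, ?_⟩
  filter_upwards [hev, htend.abs.eventually_le_const (lt_add_one _)] with x h6 h7
  rw [h6]
  exact h7

/-! ### Resultants and quadratic reciprocity -/

section Reciprocity

variable {F : Type*} [Field F]

/-- Both sides are the product of `f` over the roots of `P` in an algebraic closure. -/
theorem norm_mk_eq_resultant [Finite F] {P : F[X]} (hP : P.Monic) (hirr : Irreducible P)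
    (f : F[X]) : Algebra.norm F (AdjoinRoot.mk P f) = resultant P f := by
  have : Fact (Irreducible P) := ⟨hirr⟩
  have : Module.Finite F (AdjoinRoot P) := hP.finite_adjoinRoot
  classical
  let E := AlgebraicClosure F
  apply (algebraMap F E).injective
  rw [Algebra.norm_eq_prod_embeddings, ← resultant_map_map]
  have hs : (P.map (algebraMap F E)).Splits := IsAlgClosed.splits _
  have h1 := resultant_eq_prod_eval (P.map (algebraMap F E)) (f.map (algebraMap F E)) f.natDegree
    natDegree_map_le hs
  rw [natDegree_map] at h1
  rw [h1, (hP.map _).leadingCoeff, one_pow, one_mul]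
  have hnd : (P.aroots E).Nodup :=
    nodup_aroots_iff_of_splits hP.ne_zero hs |>.mpr (PerfectField.separable_of_irreducible hirr)
  change _ = ((P.aroots E).map _).prod
  have h2 : ∀ σ : AdjoinRoot P →ₐ[F] E, σ (AdjoinRoot.mk P f)
      = eval (AdjoinRoot.equiv E F P hP.ne_zero σ : E) (f.map (algebraMap F E)) := by
    intro σ
    rw [← AdjoinRoot.aeval_eq, ← aeval_algHom_apply, eval_map_algebraMap]
    rfl
  simp_rw [h2]
  rw [(AdjoinRoot.equiv E F P hP.ne_zero).prod_comp
    (fun x : {x // x ∈ P.aroots E} => eval (x : E) (f.map (algebraMap F E)))]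
  rw [← Finset.prod_subtype (P.aroots E).toFinset (p := fun x => x ∈ P.aroots E) (by simp)
    (fun x => eval x (f.map (algebraMap F E)))]
  rw [Finset.prod_multiset_map_count]
  refine Finset.prod_congr rfl fun x hx => ?_
  rw [Multiset.count_eq_one_of_mem hnd (by simpa using hx), pow_one]

open Classical in
/-- By Euler's criterion, since the norm of a finite field extension is the power map
`x ↦ x ^ ((|K| - 1) / (|F| - 1))`. -/
theorem quadraticChar_norm {K : Type*} [Field K] [Algebra F K] [Fintype F] [Fintype K]
    (hF : ringChar F ≠ 2) (x : K) :
    quadraticChar F (Algebra.norm F x) = quadraticChar K x := by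
  have hK : ringChar K ≠ 2 := by rwa [← Algebra.ringChar_eq F K]
  refine Int.cast_injOn_of_ringChar_ne_two hK (quadraticChar_isQuadratic F _)
    (quadraticChar_isQuadratic K _) ?_
  rw [quadraticChar_eq_pow_of_char_ne_two' hK]
  have h1 := congrArg (algebraMap F K)
    (quadraticChar_eq_pow_of_char_ne_two' hF (Algebra.norm F x))
  rw [map_intCast, map_pow, FiniteField.algebraMap_norm_eq_pow] at h1
  rw [h1, ← pow_mul]
  congr 1
  have hq : Fintype.card F % 2 = 1 := FiniteField.odd_card_of_char_ne_two hF
  have hQ : Fintype.card K % 2 = 1 := FiniteField.odd_card_of_char_ne_two hK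
  have hdvd : Nat.card F - 1 ∣ Nat.card K - 1 := by
    rw [Module.natCard_eq_pow_finrank (K := F) (V := K)]
    simpa using Nat.sub_dvd_pow_sub_pow (Nat.card F) 1 (Module.finrank F K)
  obtain ⟨k, hk⟩ := hdvd
  have hpos : 1 < Nat.card F := Finite.one_lt_card
  rw [hk, Nat.mul_div_cancel_left _ (by omega)]
  rw [Nat.card_eq_fintype_card, Nat.card_eq_fintype_card] at hk
  rw [Nat.card_eq_fintype_card] at hpos
  have h3 : Fintype.card F - 1 = 2 * (Fintype.card F / 2) := by omega
  have h4 : Fintype.card K - 1 = 2 * (Fintype.card K / 2) := by omega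
  rw [h3, h4, mul_assoc] at hk
  rw [mul_comm]
  exact (Nat.eq_of_mul_eq_mul_left two_pos hk).symm

open Classical in
/-- The Legendre symbol at `P` is the quadratic character of the residue field `F[X] / (P)`. -/
theorem polyLegendre_eq_quadraticChar_adjoinRoot {P : F[X]} [Fact (Irreducible P)]
    [Fintype (AdjoinRoot P)] (f : F[X]) :
    polyLegendre f P = quadraticChar (AdjoinRoot P) (AdjoinRoot.mk P f) := by
  rw [polyLegendre, quadraticChar_apply, quadraticCharFun]
  simp only [AdjoinRoot.mk_eq_zero]
  congr

open Classical in
/-- The Legendre symbol at `P` is the quadratic character of the norm from `F[X] / (P)`, and that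
norm is a resultant. -/
theorem polyLegendre_eq_quadraticChar_resultant [Fintype F] (hF : ringChar F ≠ 2) {P : F[X]}
    (hP : P.Monic) (hirr : Irreducible P) (f : F[X]) :
    polyLegendre f P = quadraticChar F (resultant P f) := by
  have : Fact (Irreducible P) := ⟨hirr⟩
  have : Module.Finite F (AdjoinRoot P) := hP.finite_adjoinRoot
  have : Finite (AdjoinRoot P) := Module.finite_of_finite F
  have := Fintype.ofFinite (AdjoinRoot P)
  rw [polyLegendre_eq_quadraticChar_adjoinRoot, ← norm_mk_eq_resultant hP hirr,
    quadraticChar_norm hF]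

/-- Quadratic reciprocity in `F[X]`, in the case of trivial sign. -/
theorem polyLegendre_comm_of_even [Finite F] (hF : ringChar F ≠ 2) {P Q : F[X]}
    (hP : P.Monic) (hPirr : Irreducible P) (hQ : Q.Monic) (hQirr : Irreducible Q)
    (heven : Even P.natDegree) : polyLegendre P Q = polyLegendre Q P := by
  have := Fintype.ofFinite F
  rw [polyLegendre_eq_quadraticChar_resultant hF hP hPirr,
    polyLegendre_eq_quadraticChar_resultant hF hQ hQirr, resultant_comm,
    (heven.mul_left _).neg_one_pow, one_mul]


end Reciprocity

/-! ### Elementary properties of the Legendre symbol -/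

section Legendre

variable {F : Type*} [Field F]

theorem exists_mulChar_eq_polyLegendre [Finite F] {P : F[X]} (hirr : Irreducible P) :
    ∃ χ : MulChar (AdjoinRoot P) ℤ, ∀ f, polyLegendre f P = χ (AdjoinRoot.mk P f) := by
  classical
  have : Fact (Irreducible P) := ⟨hirr⟩
  have : Module.Finite F (AdjoinRoot P) := (AdjoinRoot.powerBasis hirr.ne_zero).finite
  have : Finite (AdjoinRoot P) := Module.finite_of_finite F
  have := Fintype.ofFinite (AdjoinRoot P)
  exact ⟨quadraticChar _, polyLegendre_eq_quadraticChar_adjoinRoot⟩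

theorem polyLegendre_mul [Finite F] {P : F[X]} (hirr : Irreducible P) (f g : F[X]) :
    polyLegendre (f * g) P = polyLegendre f P * polyLegendre g P := by
  obtain ⟨χ, hχ⟩ := exists_mulChar_eq_polyLegendre hirr
  simp only [hχ, map_mul]

theorem polyLegendre_one [Finite F] {P : F[X]} (hirr : Irreducible P) :
    polyLegendre 1 P = 1 := by
  obtain ⟨χ, hχ⟩ := exists_mulChar_eq_polyLegendre hirr
  simp only [hχ, map_one]

theorem polyLegendre_prod [Finite F] {P : F[X]} (hirr : Irreducible P) {ι : Type*} (s : Finset ι)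
    (f : ι → F[X]) : polyLegendre (∏ i ∈ s, f i) P = ∏ i ∈ s, polyLegendre (f i) P := by
  obtain ⟨χ, hχ⟩ := exists_mulChar_eq_polyLegendre hirr
  simp only [hχ, map_prod]

theorem polyLegendre_congr [Finite F] {P f g : F[X]} (hirr : Irreducible P) (h : P ∣ f - g) :
    polyLegendre f P = polyLegendre g P := by
  obtain ⟨χ, hχ⟩ := exists_mulChar_eq_polyLegendre hirr
  rw [hχ, hχ, AdjoinRoot.mk_eq_mk.mpr h]

theorem polyLegendre_trichotomy (f P : F[X]) :
    (P ∣ f ∧ polyLegendre f P = 0) ∨ polyLegendre f P = 1 ∨ polyLegendre f P = -1 := by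
  unfold polyLegendre
  split_ifs with h <;> simp [h]

theorem exists_polyLegendre_eq_neg_one [Finite F] (hF : ringChar F ≠ 2) {P : F[X]}
    (hirr : Irreducible P) : ∃ f : F[X], polyLegendre f P = -1 := by
  classical
  have : Fact (Irreducible P) := ⟨hirr⟩
  have : Module.Finite F (AdjoinRoot P) := (AdjoinRoot.powerBasis hirr.ne_zero).finite
  have : Finite (AdjoinRoot P) := Module.finite_of_finite F
  have := Fintype.ofFinite (AdjoinRoot P)
  obtain ⟨a, ha⟩ := quadraticChar_exists_neg_one (F := AdjoinRoot P)
    (by rwa [← Algebra.ringChar_eq F (AdjoinRoot P)])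
  obtain ⟨f, rfl⟩ := AdjoinRoot.mk_surjective a
  exact ⟨f, by rw [polyLegendre_eq_quadraticChar_adjoinRoot, ha]⟩

end Legendre

/-! ### The `L`-series of a completely multiplicative function on `F[X]` -/

section Monics

variable (F : Type*) [Field F] [Finite F]

theorem finite_setOf_monic_natDegree_eq (n : ℕ) :
    {f : F[X] | f.Monic ∧ f.natDegree = n}.Finite := by
  have : Finite (degreeLT F n) := Finite.of_equiv _ (degreeLTEquiv F n).symm.toEquiv
  exact Finite.of_equiv _ (monicEquivDegreeLT n).symm

/-- The monic polynomials of degree `n` over a finite field. -/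
noncomputable def monicsOfDegree (n : ℕ) : Finset F[X] :=
  (finite_setOf_monic_natDegree_eq F n).toFinset

variable {F} in
@[simp]
theorem mem_monicsOfDegree {n : ℕ} {f : F[X]} :
    f ∈ monicsOfDegree F n ↔ f.Monic ∧ f.natDegree = n := by
  simp [monicsOfDegree]

theorem card_monicsOfDegree (n : ℕ) : (monicsOfDegree F n).card = Nat.card F ^ n := by
  have h := Nat.card_congr ((monicEquivDegreeLT n).trans (degreeLTEquiv F n).toEquiv)
  rw [Nat.card_fun, Nat.card_fin] at h
  rw [monicsOfDegree, ← Set.ncard_eq_toFinset_card _ (finite_setOf_monic_natDegree_eq F n), ← h]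
  rfl

open Classical in
theorem finite_setOf_primePower (n : ℕ) : {x : F[X] × ℕ | x.1.Monic ∧ Irreducible x.1 ∧
    1 ≤ x.2 ∧ x.1.natDegree * x.2 = n}.Finite := by
  refine (((Finset.range (n + 1)).biUnion (monicsOfDegree F)) ×ˢ
    Finset.range (n + 1)).finite_toSet.subset ?_
  rintro ⟨P, k⟩ ⟨hP, hirr, hk, rfl⟩
  have := hirr.natDegree_pos
  simp only [Finset.coe_product, Set.mem_prod, Finset.mem_coe, Finset.mem_biUnion,
    Finset.mem_range, mem_monicsOfDegree]
  refine ⟨⟨_, ?_, hP, rfl⟩, ?_⟩ <;> nlinarith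

/-- The pairs `(P, k)` of a monic irreducible polynomial `P` and an exponent `k ≥ 1` for which
`P ^ k` has degree `n`. -/
noncomputable def primePowersOfDegree (n : ℕ) : Finset (F[X] × ℕ) :=
  (finite_setOf_primePower F n).toFinset

variable {F}

@[simp]
theorem mem_primePowersOfDegree {n : ℕ} {x : F[X] × ℕ} :
    x ∈ primePowersOfDegree F n ↔
      x.1.Monic ∧ Irreducible x.1 ∧ 1 ≤ x.2 ∧ x.1.natDegree * x.2 = n := by
  simp [primePowersOfDegree]

theorem primePowersOfDegree_zero : primePowersOfDegree F 0 = ∅ := by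
  ext ⟨P, k⟩
  simp only [mem_primePowersOfDegree, Finset.notMem_empty, iff_false]
  rintro ⟨-, hirr, hk, h⟩
  have := hirr.natDegree_pos
  rcases Nat.mul_eq_zero.mp h with h | h <;> omega

open Classical in
/-- The analogue of `log n = ∑ d ∣ n, Λ d`: the degree of `f` is the sum of `deg P` over all prime
powers `P ^ k` dividing `f`. -/
theorem natDegree_eq_sum_primePowers {n : ℕ} {f : F[X]} (hf : f ∈ monicsOfDegree F n) :
    n = ∑ p ∈ Finset.HasAntidiagonal.antidiagonal n,
      ∑ x ∈ primePowersOfDegree F p.1 with x.1 ^ x.2 ∣ f, x.1.natDegree := by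
  obtain ⟨hmon, rfl⟩ := mem_monicsOfDegree.mp hf
  have hf0 := hmon.ne_zero
  let s := UniqueFactorizationMonoid.normalizedFactors f
  have hs : ∀ P ∈ s, P.Monic ∧ Irreducible P := fun P hP =>
    ⟨by rw [← UniqueFactorizationMonoid.normalize_normalized_factor P hP]
        exact monic_normalize
          (UniqueFactorizationMonoid.irreducible_of_normalized_factor P hP).ne_zero,
      UniqueFactorizationMonoid.irreducible_of_normalized_factor P hP⟩
  have hprod : s.prod = f := by
    have h1 := UniqueFactorizationMonoid.prod_normalizedFactors hf0
    exact eq_of_monic_of_associated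
      (by simpa using monic_multiset_prod_of_monic s id fun P hP => (hs P hP).1) hmon h1
  have hdvd : ∀ P : F[X], P.Monic → Irreducible P → ∀ k, P ^ k ∣ f ↔ k ≤ s.count P := by
    intro P hP hirr k
    rw [UniqueFactorizationMonoid.dvd_iff_normalizedFactors_le_normalizedFactors
      (pow_ne_zero _ hP.ne_zero) hf0, UniqueFactorizationMonoid.normalizedFactors_pow,
      UniqueFactorizationMonoid.normalizedFactors_irreducible hirr, hP.normalize_eq_self,
      Multiset.nsmul_singleton, Multiset.le_count_iff_replicate_le]
  have hdeg : f.natDegree = ∑ P ∈ s.toFinset, s.count P * P.natDegree := by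
    conv_lhs => rw [← hprod]
    rw [natDegree_multiset_prod_of_monic _ fun P hP => (hs P hP).1, Finset.sum_multiset_map_count]
    simp
  rw [Finset.Nat.sum_antidiagonal_eq_sum_range_succ_mk]
  rw [← Finset.sum_biUnion (f := fun x : F[X] × ℕ => x.1.natDegree)
    (t := fun j => (primePowersOfDegree F j).filter fun x => x.1 ^ x.2 ∣ f)]
  · conv_lhs => rw [hdeg]
    have h2 : ∀ P ∈ s.toFinset, s.count P * P.natDegree
        = ∑ _k ∈ Finset.Icc 1 (s.count P), P.natDegree := by simp
    rw [Finset.sum_congr rfl h2, Finset.sum_sigma']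
    refine Finset.sum_nbij' (fun x => (x.1, x.2)) (fun x => ⟨x.1, x.2⟩) ?_ ?_ ?_ ?_ ?_
    · rintro ⟨P, k⟩ hx
      simp only [Finset.mem_sigma, Multiset.mem_toFinset, Finset.mem_Icc] at hx
      obtain ⟨hP, hk1, hk⟩ := hx
      have h3 := (hdvd P (hs P hP).1 (hs P hP).2 k).mpr hk
      have h4 := natDegree_le_of_dvd h3 hf0
      rw [natDegree_pow] at h4
      simp only [Finset.mem_biUnion, Finset.mem_range, Finset.mem_filter, mem_primePowersOfDegree]
      exact ⟨_, by rw [Nat.lt_succ_iff, mul_comm]; exact h4,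
        ⟨(hs P hP).1, (hs P hP).2, hk1, rfl⟩, h3⟩
    · rintro ⟨P, k⟩ hx
      simp only [Finset.mem_biUnion, Finset.mem_range, Finset.mem_filter,
        mem_primePowersOfDegree] at hx
      obtain ⟨j, -, ⟨hP, hirr, hk, -⟩, hd⟩ := hx
      have h3 := (hdvd P hP hirr k).mp hd
      simp only [Finset.mem_sigma, Multiset.mem_toFinset, Finset.mem_Icc]
      exact ⟨Multiset.count_pos.mp (by omega), hk, h3⟩
    · intros; rfl
    · intros; rfl
    · intros; rfl
  · intro i _ j _ hij
    rw [Function.onFun, Finset.disjoint_left]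
    intro x hx hx'
    rw [Finset.mem_filter, mem_primePowersOfDegree] at hx hx'
    exact hij (hx.1.2.2.2.symm.trans hx'.1.2.2.2)

/-- The coefficient of `u ^ n` in the `L`-series of a completely multiplicative function `χ`: the
sum of `χ` over the monic polynomials of degree `n`. -/
noncomputable def lCoeff (χ : F[X] →* ℝ) (n : ℕ) : ℝ := ∑ f ∈ monicsOfDegree F n, χ f

/-- The coefficient of `u ^ n` in `u L'(u) / L(u)` for the `L`-series of `χ`: the sum of `Λ χ` over
the monic polynomials of degree `n`, where `Λ(P ^ k) = deg P` and `Λ` vanishes off prime powers. -/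
noncomputable def logDerivCoeff (χ : F[X] →* ℝ) (n : ℕ) : ℝ :=
  ∑ x ∈ primePowersOfDegree F n, x.1.natDegree * χ x.1 ^ x.2

theorem lCoeff_zero (χ : F[X] →* ℝ) : lCoeff χ 0 = 1 := by
  have : monicsOfDegree F 0 = {1} := by
    ext f
    simp only [mem_monicsOfDegree, Finset.mem_singleton]
    exact ⟨fun h => h.1.natDegree_eq_zero.mp h.2, by rintro rfl; simp⟩
  rw [lCoeff, this, Finset.sum_singleton, map_one]

theorem logDerivCoeff_zero (χ : F[X] →* ℝ) : logDerivCoeff χ 0 = 0 := by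
  rw [logDerivCoeff, primePowersOfDegree_zero, Finset.sum_empty]

open Classical in
theorem sum_monicsOfDegree_dvd (χ : F[X] →* ℝ) {D : F[X]} (hD : D.Monic) {a b : ℕ}
    (ha : D.natDegree = a) :
    ∑ f ∈ monicsOfDegree F (a + b) with D ∣ f, χ f = χ D * lCoeff χ b := by
  rw [lCoeff, Finset.mul_sum]
  symm
  refine Finset.sum_nbij (fun g => D * g) ?_ ?_ ?_ ?_
  · intro g hg
    rw [mem_monicsOfDegree] at hg
    rw [Finset.mem_filter, mem_monicsOfDegree, hD.natDegree_mul hg.1, ha, hg.2]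
    exact ⟨⟨hD.mul hg.1, rfl⟩, dvd_mul_right _ _⟩
  · intro g _ g' _ h
    exact mul_left_cancel₀ hD.ne_zero h
  · intro f hf
    rw [Finset.mem_coe, Finset.mem_filter, mem_monicsOfDegree] at hf
    obtain ⟨⟨hf, hdeg⟩, g, rfl⟩ := hf
    have hg := hD.of_mul_monic_left hf
    rw [hD.natDegree_mul hg, ha] at hdeg
    exact ⟨g, by rw [Finset.mem_coe, mem_monicsOfDegree]; exact ⟨hg, by omega⟩, rfl⟩
  · intro g _
    rw [map_mul]

open Classical in
/-- The identity `u L' = L * (u L' / L)` on coefficients. -/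
theorem natCast_mul_lCoeff (χ : F[X] →* ℝ) (n : ℕ) :
    n * lCoeff χ n = ∑ p ∈ Finset.HasAntidiagonal.antidiagonal n,
      logDerivCoeff χ p.1 * lCoeff χ p.2 := by
  have h1 : n * lCoeff χ n = ∑ f ∈ monicsOfDegree F n,
      ∑ p ∈ Finset.HasAntidiagonal.antidiagonal n, ∑ x ∈ primePowersOfDegree F p.1,
        if x.1 ^ x.2 ∣ f then x.1.natDegree * χ f else 0 := by
    rw [lCoeff, Finset.mul_sum]
    refine Finset.sum_congr rfl fun f hf => ?_
    conv_lhs => rw [natDegree_eq_sum_primePowers hf]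
    push_cast
    simp_rw [Finset.sum_mul, Finset.sum_filter]
  rw [h1, Finset.sum_comm]
  refine Finset.sum_congr rfl fun p hp => ?_
  rw [Finset.sum_comm, logDerivCoeff, Finset.sum_mul]
  refine Finset.sum_congr rfl fun x hx => ?_
  obtain ⟨hP, -, -, hdeg⟩ := mem_primePowersOfDegree.mp hx
  rw [← Finset.sum_filter, ← Finset.mul_sum, ← Finset.HasAntidiagonal.mem_antidiagonal.mp hp,
    sum_monicsOfDegree_dvd χ (hP.pow x.2) (by rw [natDegree_pow, mul_comm, hdeg]),
    map_pow, mul_assoc]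

/-- The prime polynomial theorem in the form `∑ Λ(f) = q ^ n`, over the monic `f` of degree `n`. -/
theorem sum_natDegree_primePowersOfDegree {n : ℕ} (hn : 1 ≤ n) :
    ∑ x ∈ primePowersOfDegree F n, (x.1.natDegree : ℝ) = (Nat.card F : ℝ) ^ n := by
  have hl : ∀ n, lCoeff (1 : F[X] →* ℝ) n = (Nat.card F : ℝ) ^ n := by
    intro n
    simp [lCoeff, card_monicsOfDegree]
  have hc : logDerivCoeff (1 : F[X] →* ℝ) n
      = ∑ x ∈ primePowersOfDegree F n, (x.1.natDegree : ℝ) := by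
    simp [logDerivCoeff]
  have h := natCast_mul_lCoeff (1 : F[X] →* ℝ)
  simp only [hl] at h
  obtain ⟨m, rfl⟩ : ∃ m, n = m + 1 := ⟨n - 1, by omega⟩
  have h1 := h (m + 1)
  rw [Finset.Nat.sum_antidiagonal_succ'] at h1
  simp only [pow_succ, pow_zero, mul_one, ← mul_assoc] at h1
  rw [← Finset.sum_mul, ← h m, hc] at h1
  rw [pow_succ]
  push_cast at h1
  linarith

theorem abs_logDerivCoeff_le {χ : F[X] →* ℝ} (hχ : ∀ f, |χ f| ≤ 1) (n : ℕ) :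
    |logDerivCoeff χ n| ≤ (Nat.card F : ℝ) ^ n := by
  rcases Nat.eq_zero_or_pos n with rfl | hn
  · simp [logDerivCoeff_zero]
  · rw [← sum_natDegree_primePowersOfDegree hn]
    refine (Finset.abs_sum_le_sum_abs _ _).trans (Finset.sum_le_sum fun x _ => ?_)
    rw [abs_mul, abs_pow, Nat.abs_cast]
    exact mul_le_of_le_one_right (by positivity) (pow_le_one₀ (abs_nonneg _) (hχ _))

/-- For even `n` the prime power `X ^ n` forces a strict inequality. -/
theorem neg_card_pow_lt_logDerivCoeff {χ : F[X] →* ℝ} (hχ : ∀ f, |χ f| ≤ 1) {n : ℕ} (hn : 1 ≤ n)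
    (heven : Even n) : -(Nat.card F : ℝ) ^ n < logDerivCoeff χ n := by
  rw [neg_lt_iff_pos_add', ← sum_natDegree_primePowersOfDegree hn, logDerivCoeff,
    ← Finset.sum_add_distrib]
  refine Finset.sum_pos' (fun x _ => ?_) ⟨(X, n), ?_, ?_⟩
  · have h1 : |χ x.1 ^ x.2| ≤ 1 := by
      rw [abs_pow]
      exact pow_le_one₀ (abs_nonneg _) (hχ _)
    have h2 := (abs_le.mp h1).1
    rw [← mul_one_add]
    exact mul_nonneg (Nat.cast_nonneg _) (by linarith)
  · simp [monic_X, irreducible_X, hn]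
  · have := heven.pow_nonneg (χ X)
    simp only [natDegree_X]
    push_cast
    linarith

/-- Orthogonality: multiplication by `c` permutes the residues modulo `m`, and a monic polynomial of
degree `n ≥ deg m` is a monic multiple of `m` plus an arbitrary residue. -/
theorem lCoeff_eq_zero {χ : F[X] →* ℝ} {m c : F[X]} (hm : m.Monic)
    (hper : ∀ f g, m ∣ f - g → χ f = χ g) (hc : IsCoprime m c) (hχc : χ c ≠ 1) {n : ℕ}
    (hn : m.natDegree ≤ n) : lCoeff χ n = 0 := by
  let σ : F[X] → F[X] := fun f => m * (f /ₘ m) + (c * f) %ₘ m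
  have hmod : ∀ f, m ∣ σ f - c * f := fun f => by
    have h := modByMonic_add_div (c * f) m
    exact ⟨f /ₘ m - (c * f) /ₘ m, by simp only [σ]; linear_combination h⟩
  have hdiv : ∀ f, σ f /ₘ m = f /ₘ m := fun f =>
    (div_modByMonic_unique _ ((c * f) %ₘ m) hm
      ⟨by simp only [σ]; ring, degree_modByMonic_lt _ hm⟩).1
  have hmem : ∀ f ∈ monicsOfDegree F n, σ f ∈ monicsOfDegree F n := by
    intro f hf
    rw [mem_monicsOfDegree] at hf ⊢
    have hdeg : m.degree ≤ f.degree := by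
      rw [degree_eq_natDegree hm.ne_zero, degree_eq_natDegree hf.1.ne_zero, hf.2]
      exact_mod_cast hn
    have hq : (f /ₘ m).Monic := by
      rw [Monic, leadingCoeff_divByMonic_of_monic hm hdeg]
      exact hf.1
    have hlt : ((c * f) %ₘ m).degree < (m * (f /ₘ m)).degree := by
      refine (degree_modByMonic_lt _ hm).trans_le ?_
      rw [degree_mul]
      exact le_add_of_nonneg_right (zero_le_degree_iff.mpr hq.ne_zero)
    refine ⟨(hm.mul hq).add_of_left hlt, ?_⟩
    rw [natDegree_add_eq_left_of_degree_lt hlt, hm.natDegree_mul hq, natDegree_divByMonic _ hm,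
      hf.2]
    omega
  have hinj : Set.InjOn σ (monicsOfDegree F n) := by
    intro f _ g _ h
    have h1 : m ∣ c * (f - g) := by
      have h2 := dvd_sub (hmod g) (hmod f)
      rw [h] at h2
      convert h2 using 1
      ring
    obtain ⟨k, hk⟩ := hc.dvd_of_dvd_mul_left h1
    have h3 : f /ₘ m = g /ₘ m := by rw [← hdiv f, ← hdiv g, h]
    have h4 : f %ₘ m = g %ₘ m := by
      rw [← sub_eq_zero, ← sub_modByMonic, hk, mul_comm, mul_self_modByMonic hm]
    rw [← modByMonic_add_div f m, ← modByMonic_add_div g m, h3, h4]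
  have h5 : lCoeff χ n = χ c * lCoeff χ n := by
    rw [lCoeff, Finset.mul_sum]
    symm
    refine Finset.sum_nbij σ hmem hinj
      (Finset.surjOn_of_injOn_of_card_le σ hmem hinj le_rfl) fun f _ => ?_
    rw [← map_mul]
    exact (hper _ _ (hmod f)).symm
  have h6 : (1 - χ c) * lCoeff χ n = 0 := by linear_combination h5
  exact (mul_eq_zero.mp h6).resolve_left (sub_ne_zero.mpr hχc.symm)

end Monics

/-! ### Even parts of logarithmic derivatives -/

section EvenPart

variable {F : Type*} [Field F] [Finite F]

/-- Boundedness of `u L'(u) / L(u)` as `u` tends to `1 / q` (for `ε = 1`) or to `-1 / q` (for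
`ε = -1`), with `u = ε x / q`. -/
theorem eventually_abs_tsum_sign_mul_logDerivCoeff_le {χ : F[X] →* ℝ} (hχ : ∀ f, |χ f| ≤ 1) {d : ℕ}
    (hd : ∀ n, d ≤ n → lCoeff χ n = 0) {ε : ℝ} (hε : ε = 1 ∨ ε = -1) :
    ∃ B : ℝ, ∀ᶠ x in 𝓝[<] (1 : ℝ),
      |∑' n, (ε ^ n * (logDerivCoeff χ n / (Nat.card F : ℝ) ^ n)) * x ^ n| ≤ B := by
  have hq : (0 : ℝ) < Nat.card F := by exact_mod_cast Nat.card_pos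
  have hε1 : |ε| = 1 := by rcases hε with rfl | rfl <;> simp
  let L : ℝ[X] := ∑ n ∈ Finset.range d, monomial n (ε ^ n * (lCoeff χ n / (Nat.card F : ℝ) ^ n))
  have hL : ∀ n, L.coeff n = ε ^ n * (lCoeff χ n / (Nat.card F : ℝ) ^ n) := by
    intro n
    simp only [L, finsetSum_coeff, coeff_monomial, Finset.sum_ite_eq', Finset.mem_range]
    split_ifs with h
    · rfl
    · rw [hd n (by omega)]; simp
  refine eventually_abs_tsum_le_of_logDeriv_coeff (L := L) ?_ ?_ ?_ ?_ ?_
  · rw [hL, lCoeff_zero]; simp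
  · rw [logDerivCoeff_zero]; simp
  · intro n
    rw [abs_mul, abs_pow, hε1, one_pow, one_mul, abs_div, abs_of_pos (pow_pos hq n)]
    exact div_le_one_of_le₀ (abs_logDerivCoeff_le hχ n) (pow_pos hq n).le
  · intro N
    refine ⟨2 * N + 2, by omega, ?_⟩
    have heven : Even (2 * N + 2) := ⟨N + 1, by ring⟩
    have h1 : ε ^ (2 * N + 2) = 1 := by
      rw [← heven.pow_abs, hε1, one_pow]
    rw [h1, one_mul, lt_div_iff₀ (pow_pos hq _), neg_one_mul]
    exact neg_card_pow_lt_logDerivCoeff hχ (by omega) heven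
  · intro n
    have h := natCast_mul_lCoeff χ n
    calc (n : ℝ) * L.coeff n
        = ε ^ n * ((n * lCoeff χ n) / (Nat.card F : ℝ) ^ n) := by rw [hL]; ring
      _ = _ := by
        rw [h, Finset.sum_div, Finset.mul_sum]
        refine Finset.sum_congr rfl fun p hp => ?_
        rw [hL, ← Finset.HasAntidiagonal.mem_antidiagonal.mp hp, pow_add, pow_add, mul_div_mul_comm]
        ring

theorem summable_sign_mul_logDerivCoeff {χ : F[X] →* ℝ} (hχ : ∀ f, |χ f| ≤ 1) {ε : ℝ}
    (hε : ε = 1 ∨ ε = -1) {x : ℝ} (hx : |x| < 1) :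
    Summable fun n => (ε ^ n * (logDerivCoeff χ n / (Nat.card F : ℝ) ^ n)) * x ^ n := by
  have hq : (0 : ℝ) < Nat.card F := by exact_mod_cast Nat.card_pos
  have hε1 : |ε| = 1 := by rcases hε with rfl | rfl <;> simp
  refine (summable_mul_pow_of_abs_le_one (fun n => ?_) hx).of_norm
  rw [abs_mul, abs_pow, hε1, one_pow, one_mul, abs_div, abs_of_pos (pow_pos hq n)]
  exact div_le_one_of_le₀ (abs_logDerivCoeff_le hχ n) (pow_pos hq n).le

/-- Twice the even part of `u L'(u) / L(u)`, as a power series in `u`, evaluated at `u = x / q`.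
Meaningful for `|x| < 1`, where the series converges. -/
noncomputable def evenLogDeriv (χ : F[X] →* ℝ) (x : ℝ) : ℝ :=
  ∑' n, ((1 + (-1) ^ n) * (logDerivCoeff χ n / (Nat.card F : ℝ) ^ n)) * x ^ n

theorem hasSum_evenLogDeriv {χ : F[X] →* ℝ} (hχ : ∀ f, |χ f| ≤ 1) {x : ℝ} (hx : |x| < 1) :
    HasSum (fun n => ((1 + (-1) ^ n) * (logDerivCoeff χ n / (Nat.card F : ℝ) ^ n)) * x ^ n)
      (∑' n, (1 ^ n * (logDerivCoeff χ n / (Nat.card F : ℝ) ^ n)) * x ^ n +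
        ∑' n, ((-1) ^ n * (logDerivCoeff χ n / (Nat.card F : ℝ) ^ n)) * x ^ n) := by
  convert (summable_sign_mul_logDerivCoeff hχ (Or.inl rfl) hx).hasSum.add
    (summable_sign_mul_logDerivCoeff hχ (Or.inr rfl) hx).hasSum using 2 with n
  ring

theorem eventually_abs_evenLogDeriv_le {χ : F[X] →* ℝ} (hχ : ∀ f, |χ f| ≤ 1) {d : ℕ}
    (hd : ∀ n, d ≤ n → lCoeff χ n = 0) :
    ∃ B : ℝ, ∀ᶠ x in 𝓝[<] (1 : ℝ), |evenLogDeriv χ x| ≤ B := by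
  obtain ⟨B₁, h₁⟩ := eventually_abs_tsum_sign_mul_logDerivCoeff_le hχ hd (Or.inl rfl)
  obtain ⟨B₂, h₂⟩ := eventually_abs_tsum_sign_mul_logDerivCoeff_le hχ hd (Or.inr rfl)
  have h₃ : ∀ᶠ x in 𝓝[<] (1 : ℝ), x ∈ Set.Ioo (0 : ℝ) 1 := Ioo_mem_nhdsLT zero_lt_one
  refine ⟨B₁ + B₂, ?_⟩
  filter_upwards [h₁, h₂, h₃] with x h₁ h₂ h₃
  rw [evenLogDeriv, (hasSum_evenLogDeriv hχ (abs_lt.mpr ⟨by linarith [h₃.1], h₃.2⟩)).tsum_eq]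
  exact (abs_add_le _ _).trans (add_le_add h₁ h₂)

/-- For the trivial character the coefficients are `q ^ n`, and the even part has a pole. -/
theorem tendsto_evenLogDeriv_one :
    Tendsto (evenLogDeriv (1 : F[X] →* ℝ)) (𝓝[<] 1) atTop := by
  have hq : (0 : ℝ) < Nat.card F := by exact_mod_cast Nat.card_pos
  have hc : ∀ n, logDerivCoeff (1 : F[X] →* ℝ) n / (Nat.card F : ℝ) ^ n
      = if n = 0 then 0 else 1 := by
    intro n
    split_ifs with h
    · rw [h, logDerivCoeff_zero, zero_div]
    · have := sum_natDegree_primePowersOfDegree (F := F) (Nat.one_le_iff_ne_zero.mpr h)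
      rw [logDerivCoeff]
      simp only [MonoidHom.one_apply, one_pow, mul_one]
      rw [this, div_self (pow_pos hq n).ne']
  have h1 : ∀ x ∈ Set.Ioo (0 : ℝ) 1, (1 - x)⁻¹ + -2 ≤ evenLogDeriv (1 : F[X] →* ℝ) x := by
    intro x hx
    have h2 := (hasSum_geometric_of_lt_one hx.1.le hx.2).add
      (hasSum_geometric_of_abs_lt_one (r := -x) (by rw [abs_neg, abs_of_pos hx.1]; exact hx.2))
    have h3 := h2.sub (hasSum_ite_eq 0 (2 : ℝ))
    have h4 : evenLogDeriv (1 : F[X] →* ℝ) x = (1 - x)⁻¹ + (1 - -x)⁻¹ - 2 := by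
      rw [evenLogDeriv, ← h3.tsum_eq]
      refine tsum_congr fun n => ?_
      rw [hc, neg_pow x]
      split_ifs with h
      · simp [h]; norm_num
      · ring
    have h5 : 0 ≤ (1 - -x)⁻¹ := inv_nonneg.mpr (by linarith [hx.1])
    rw [h4]
    linarith
  have h6 : Tendsto (fun x : ℝ => (1 - x)⁻¹) (𝓝[<] 1) atTop := by
    refine tendsto_inv_nhdsGT_zero.comp (tendsto_nhdsWithin_iff.mpr ⟨?_, ?_⟩)
    · have : Tendsto (fun x : ℝ => 1 - x) (𝓝 1) (𝓝 (1 - 1)) :=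
        (continuous_const.sub continuous_id).tendsto 1
      rw [sub_self] at this
      exact this.mono_left nhdsWithin_le_nhds
    · filter_upwards [self_mem_nhdsWithin] with x hx
      exact sub_pos.mpr (Set.mem_Iio.mp hx)
  refine tendsto_atTop_mono' _ ?_ (tendsto_atTop_add_const_right _ (-2) h6)
  filter_upwards [Ioo_mem_nhdsLT (zero_lt_one (α := ℝ))] with x hx using h1 x hx

/-- Proper prime powers are negligible: such a `P ^ k` of degree `n` is determined by `P`, and
`deg P ≤ n / 2`. -/
theorem sum_natDegree_primePowersOfDegree_two_le (n : ℕ) :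
    ∑ x ∈ primePowersOfDegree F n with 2 ≤ x.2, x.1.natDegree
      ≤ n * (n + 1) * Nat.card F ^ (n / 2) := by
  classical
  have hq : 0 < Nat.card F := Nat.card_pos
  have hcard : ((primePowersOfDegree F n).filter fun x => 2 ≤ x.2).card
      ≤ (n + 1) * Nat.card F ^ (n / 2) := by
    calc _ ≤ ((Finset.range (n / 2 + 1)).biUnion (monicsOfDegree F)).card := by
          refine Finset.card_le_card_of_injOn Prod.fst ?_ ?_
          · rintro ⟨P, k⟩ hx
            simp only [Finset.mem_coe, Finset.mem_filter, mem_primePowersOfDegree] at hx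
            simp only [Finset.mem_coe, Finset.mem_biUnion, Finset.mem_range, mem_monicsOfDegree]
            refine ⟨_, ?_, hx.1.1, rfl⟩
            have := Nat.mul_le_mul_left P.natDegree hx.2
            omega
          · rintro ⟨P, k⟩ hx ⟨Q, j⟩ hy (rfl : P = Q)
            simp only [Finset.mem_coe, Finset.mem_filter, mem_primePowersOfDegree] at hx hy
            have h := hx.1.2.2.2.trans hy.1.2.2.2.symm
            rw [Nat.eq_of_mul_eq_mul_left hx.1.2.1.natDegree_pos h]
      _ ≤ ∑ j ∈ Finset.range (n / 2 + 1), (monicsOfDegree F j).card := Finset.card_biUnion_le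
      _ ≤ ∑ j ∈ Finset.range (n / 2 + 1), Nat.card F ^ (n / 2) := by
          refine Finset.sum_le_sum fun j hj => ?_
          rw [card_monicsOfDegree]
          exact Nat.pow_le_pow_right hq (by rw [Finset.mem_range] at hj; omega)
      _ ≤ _ := by
          rw [Finset.sum_const, Finset.card_range, smul_eq_mul]
          exact Nat.mul_le_mul_right _ (by omega)
  calc _ ≤ ∑ x ∈ primePowersOfDegree F n with 2 ≤ x.2, n := by
        refine Finset.sum_le_sum fun x hx => ?_
        rw [Finset.mem_filter, mem_primePowersOfDegree] at hx
        rw [← hx.1.2.2.2]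
        exact Nat.le_mul_of_pos_right _ hx.1.2.2.1
    _ ≤ _ := by
        rw [Finset.sum_const, smul_eq_mul, mul_comm, mul_assoc]
        exact Nat.mul_le_mul_left _ hcard

theorem summable_mul_card_pow_half :
    Summable fun n : ℕ => (n * (n + 1) * (Nat.card F : ℝ) ^ (n / 2)) / (Nat.card F : ℝ) ^ n := by
  have hq : (1 : ℝ) < Nat.card F := by exact_mod_cast Finite.one_lt_card
  set s := √(Nat.card F : ℝ)
  have hs2 : s ^ 2 = Nat.card F := Real.sq_sqrt (by linarith)
  have hs : 1 < s := by
    rw [Real.lt_sqrt zero_le_one]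
    simpa using hq
  have hr : ‖s⁻¹‖ < 1 := by
    rw [Real.norm_of_nonneg (by positivity)]
    exact inv_lt_one_of_one_lt₀ hs
  refine Summable.of_nonneg_of_le (fun n => by positivity) (fun n => ?_)
    ((summable_pow_mul_geometric_of_norm_lt_one 2 hr).add
      (summable_pow_mul_geometric_of_norm_lt_one 1 hr))
  have h1 : (Nat.card F : ℝ) ^ (n / 2) ≤ s ^ n := by
    rw [← hs2, ← pow_mul]
    exact pow_le_pow_right₀ hs.le (Nat.mul_div_le n 2)
  have h2 : (Nat.card F : ℝ) ^ n = s ^ n * s ^ n := by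
    rw [← hs2, ← pow_mul, ← pow_add, two_mul]
  rw [h2]
  have hsn : 0 < s ^ n := by positivity
  calc _ ≤ (n * (n + 1) * s ^ n) / (s ^ n * s ^ n) := by gcongr
    _ = _ := by rw [inv_pow]; field_simp

end EvenPart

/-! ### Products of Legendre symbols and simultaneous non-residues -/

section LegendreChar

variable {F : Type*} [Field F] [Finite F] {ι : Type*} {ϖ : ι → F[X]}

/-- The product over `i ∈ s` of the Legendre symbols at `ϖ i`. -/
noncomputable def legendreChar (hirr : ∀ i, Irreducible (ϖ i)) (s : Finset ι) : F[X] →* ℝ where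
  toFun f := ∏ i ∈ s, (polyLegendre f (ϖ i) : ℝ)
  map_one' := Finset.prod_eq_one fun i _ => by rw [polyLegendre_one (hirr i), Int.cast_one]
  map_mul' f g := by
    rw [← Finset.prod_mul_distrib]
    exact Finset.prod_congr rfl fun i _ => by rw [polyLegendre_mul (hirr i), Int.cast_mul]

theorem legendreChar_apply (hirr : ∀ i, Irreducible (ϖ i)) (s : Finset ι) (f : F[X]) :
    legendreChar hirr s f = ∏ i ∈ s, (polyLegendre f (ϖ i) : ℝ) := rfl

theorem legendreChar_empty (hirr : ∀ i, Irreducible (ϖ i)) : legendreChar hirr ∅ = 1 := by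
  ext f
  simp [legendreChar_apply]

theorem abs_polyLegendre_le_one {F : Type*} [Field F] (f P : F[X]) :
    |(polyLegendre f P : ℝ)| ≤ 1 := by
  rcases polyLegendre_trichotomy f P with ⟨-, h⟩ | h | h <;> simp [h]

theorem abs_legendreChar_le_one (hirr : ∀ i, Irreducible (ϖ i)) (s : Finset ι) (f : F[X]) :
    |legendreChar hirr s f| ≤ 1 := by
  rw [legendreChar_apply, Finset.abs_prod]
  exact Finset.prod_le_one (fun _ _ => abs_nonneg _) fun i _ => abs_polyLegendre_le_one _ _

theorem isCoprime_of_irreducible_of_ne {F : Type*} [Field F] {P Q : F[X]} (hP : P.Monic)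
    (hQ : Q.Monic) (hPirr : Irreducible P) (hQirr : Irreducible Q) (hne : P ≠ Q) :
    IsCoprime P Q :=
  hPirr.coprime_iff_not_dvd.mpr fun h =>
    hne (eq_of_monic_of_associated hP hQ (hPirr.associated_of_dvd hQirr h))

/-- A nonempty product of distinct Legendre symbols is a nontrivial character modulo `∏ ϖ i`, so its
`L`-series is a polynomial. -/
theorem lCoeff_legendreChar_eq_zero (hF : ringChar F ≠ 2) (hinj : Function.Injective ϖ)
    (hmon : ∀ i, (ϖ i).Monic) (hirr : ∀ i, Irreducible (ϖ i)) {s : Finset ι} (hs : s.Nonempty)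
    {n : ℕ} (hn : (∏ i ∈ s, ϖ i).natDegree ≤ n) : lCoeff (legendreChar hirr s) n = 0 := by
  classical
  obtain ⟨j, hj⟩ := hs
  obtain ⟨a, ha⟩ := exists_polyLegendre_eq_neg_one hF (hirr j)
  have hcop : IsCoprime (ϖ j) (∏ i ∈ s.erase j, ϖ i) := IsCoprime.prod_right fun i hi =>
    isCoprime_of_irreducible_of_ne (hmon j) (hmon i) (hirr j) (hirr i)
      fun h => Finset.ne_of_mem_erase hi (hinj h).symm
  -- by the Chinese remainder theorem, `c` is a non-residue at `ϖ j` and `1` at the other `ϖ i`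
  obtain ⟨c, hcj, hc1⟩ : ∃ c, ϖ j ∣ c - a ∧ (∏ i ∈ s.erase j, ϖ i) ∣ c - 1 := by
    obtain ⟨u, v, huv⟩ := hcop
    refine ⟨a * (v * ∏ i ∈ s.erase j, ϖ i) + u * ϖ j, ⟨u - a * u, ?_⟩, ⟨a * v - v, ?_⟩⟩
    · linear_combination a * huv
    · linear_combination huv
  have hcj' : polyLegendre c (ϖ j) = -1 := by rw [polyLegendre_congr (hirr j) hcj, ha]
  have hci : ∀ i ∈ s.erase j, polyLegendre c (ϖ i) = 1 := fun i hi => by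
    rw [polyLegendre_congr (hirr i) ((Finset.dvd_prod_of_mem ϖ hi).trans hc1),
      polyLegendre_one (hirr i)]
  refine lCoeff_eq_zero (m := ∏ i ∈ s, ϖ i) (c := c) (monic_prod_of_monic _ _ fun i _ => hmon i)
    (fun f g hfg => ?_) (IsCoprime.prod_left fun i hi => ?_) ?_ hn
  · rw [legendreChar_apply, legendreChar_apply]
    exact Finset.prod_congr rfl fun i hi => by
      rw [polyLegendre_congr (hirr i) ((Finset.dvd_prod_of_mem ϖ hi).trans hfg)]
  · refine (hirr i).coprime_iff_not_dvd.mpr fun hdvd => ?_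
    have h0 : polyLegendre c (ϖ i) = 0 := by rw [polyLegendre, if_pos hdvd]
    rcases eq_or_ne i j with rfl | hij
    · rw [hcj'] at h0; norm_num at h0
    · rw [hci i (Finset.mem_erase.mpr ⟨hij, hi⟩)] at h0; norm_num at h0
  · rw [legendreChar_apply, ← Finset.mul_prod_erase s _ hj, hcj',
      Finset.prod_congr rfl fun i hi => by rw [hci i hi]]
    norm_num

/-- Expanding the indicator `∏ (1 - χ i)` of simultaneous non-residues into characters. -/
theorem sum_neg_one_pow_card_mul_logDerivCoeff [Fintype ι] (hirr : ∀ i, Irreducible (ϖ i)) (n : ℕ) :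
    ∑ s : Finset ι, (-1) ^ s.card * logDerivCoeff (legendreChar hirr s) n
      = ∑ x ∈ primePowersOfDegree F n,
        x.1.natDegree * ∏ i, (1 - (polyLegendre x.1 (ϖ i) : ℝ) ^ x.2) := by
  classical
  simp_rw [logDerivCoeff, Finset.mul_sum]
  rw [Finset.sum_comm]
  refine Finset.sum_congr rfl fun x _ => ?_
  simp_rw [sub_eq_add_neg]
  rw [Finset.prod_one_add, Finset.mul_sum, Finset.powerset_univ]
  refine Finset.sum_congr rfl fun s _ => ?_
  rw [Finset.prod_neg, legendreChar_apply, Finset.prod_pow]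
  ring

/-- If no monic irreducible polynomial of even degree is a non-residue at every `ϖ i`, then for
large even `n` only the prime powers `P ^ k` with `k ≥ 2` contribute. -/
theorem abs_sum_prod_one_sub_polyLegendre_le [Fintype ι] (hmon : ∀ i, (ϖ i).Monic)
    (hirr : ∀ i, Irreducible (ϖ i))
    (hno : ∀ α : F[X], α.Monic → Irreducible α → Even α.natDegree →
      ∃ i, polyLegendre α (ϖ i) ≠ -1) {n : ℕ} (heven : Even n) (hn : ∀ i, (ϖ i).natDegree < n) :
    |∑ x ∈ primePowersOfDegree F n,
        x.1.natDegree * ∏ i, (1 - (polyLegendre x.1 (ϖ i) : ℝ) ^ x.2)|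
      ≤ 2 ^ Fintype.card ι * (n * (n + 1) * (Nat.card F : ℝ) ^ (n / 2)) := by
  have hzero : ∀ x ∈ primePowersOfDegree F n,
      (x.1.natDegree * ∏ i, (1 - (polyLegendre x.1 (ϖ i) : ℝ) ^ x.2) : ℝ) ≠ 0 → 2 ≤ x.2 := by
    rintro ⟨P, k⟩ hx hne
    obtain ⟨hP, hPirr, hk, hdeg⟩ := mem_primePowersOfDegree.mp hx
    by_contra hlt
    obtain rfl : k = 1 := by simp only at hk hlt; omega
    simp only [mul_one] at hdeg
    obtain ⟨i, hi⟩ := hno P hP hPirr (hdeg ▸ heven)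
    refine hne (mul_eq_zero_of_right _ (Finset.prod_eq_zero (Finset.mem_univ i) ?_))
    rcases polyLegendre_trichotomy P (ϖ i) with ⟨h, -⟩ | h | h
    · have := eq_of_monic_of_associated (hmon i) hP ((hirr i).associated_of_dvd hPirr h)
      have := hn i
      simp_all
    · simp [h]
    · exact absurd h hi
  rw [← Finset.sum_filter_of_ne hzero]
  have h1 : (∑ x ∈ primePowersOfDegree F n with 2 ≤ x.2, (x.1.natDegree : ℝ))
      ≤ n * (n + 1) * (Nat.card F : ℝ) ^ (n / 2) := by
    exact_mod_cast sum_natDegree_primePowersOfDegree_two_le (F := F) n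
  refine ((Finset.abs_sum_le_sum_abs _ _).trans ?_).trans
    (mul_le_mul_of_nonneg_left h1 (by positivity))
  rw [Finset.mul_sum]
  refine Finset.sum_le_sum fun x _ => ?_
  rw [abs_mul, Nat.abs_cast, mul_comm]
  refine mul_le_mul_of_nonneg_right ?_ (Nat.cast_nonneg _)
  rw [Finset.abs_prod]
  rw [← Finset.card_univ, ← Finset.prod_const]
  refine Finset.prod_le_prod (fun _ _ => abs_nonneg _) fun i _ => ?_
  have : |(polyLegendre x.1 (ϖ i) : ℝ) ^ x.2| ≤ 1 := by
    rw [abs_pow]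
    exact pow_le_one₀ (abs_nonneg _) (abs_polyLegendre_le_one _ _)
  rw [abs_le] at this ⊢
  constructor <;> linarith

theorem exists_irreducible_even_polyLegendre_eq_neg_one [Fintype ι] (hF : ringChar F ≠ 2)
    (hinj : Function.Injective ϖ) (hmon : ∀ i, (ϖ i).Monic) (hirr : ∀ i, Irreducible (ϖ i)) :
    ∃ α : F[X], α.Monic ∧ Irreducible α ∧ Even α.natDegree ∧
      ∀ i, polyLegendre α (ϖ i) = -1 := by
  classical
  by_contra hcon
  have hno : ∀ α : F[X], α.Monic → Irreducible α → Even α.natDegree →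
      ∃ i, polyLegendre α (ϖ i) ≠ -1 := by
    intro α h1 h2 h3
    by_contra h4
    exact hcon ⟨α, h1, h2, h3, by simpa using h4⟩
  have hq : (0 : ℝ) < Nat.card F := by exact_mod_cast Nat.card_pos
  -- twice the even part of the normalised sum of `Λ(f) ∏ (1 - χ i f)` over monic `f` of degree `n`
  let a : ℕ → ℝ := fun n => (1 + (-1) ^ n) * ((∑ x ∈ primePowersOfDegree F n,
    x.1.natDegree * ∏ i, (1 - (polyLegendre x.1 (ϖ i) : ℝ) ^ x.2)) / (Nat.card F : ℝ) ^ n)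
  have ha : Summable fun n => |a n| := by
    refine Summable.of_norm_bounded_eventually_nat
      ((summable_mul_card_pow_half (F := F)).mul_left (2 * 2 ^ Fintype.card ι)) ?_
    filter_upwards [eventually_gt_atTop (∑ i, (ϖ i).natDegree)] with n hn
    rw [Real.norm_eq_abs, abs_abs]
    rcases Nat.even_or_odd n with hev | hodd
    · have h1 := abs_sum_prod_one_sub_polyLegendre_le hmon hirr hno hev fun i =>
        (Finset.single_le_sum (f := fun i => (ϖ i).natDegree) (fun _ _ => Nat.zero_le _)
          (Finset.mem_univ i)).trans_lt hn
      simp only [a]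
      rw [abs_mul, abs_div, abs_of_pos (pow_pos hq n), hev.neg_one_pow, one_add_one_eq_two,
        abs_two, mul_assoc, ← mul_div_assoc (2 ^ Fintype.card ι)]
      exact mul_le_mul_of_nonneg_left (div_le_div_of_nonneg_right h1 (pow_pos hq n).le) zero_le_two
    · simp only [a]
      rw [hodd.neg_one_pow, add_neg_cancel, zero_mul, abs_zero]
      positivity
  have hsum : ∀ x : ℝ, |x| < 1 → ∑' n, a n * x ^ n
      = ∑ s : Finset ι, (-1) ^ s.card * evenLogDeriv (legendreChar hirr s) x := by
    intro x hx
    have h1 : ∀ s ∈ (Finset.univ : Finset (Finset ι)),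
        HasSum (fun n => (-1) ^ s.card * (((1 + (-1) ^ n) *
          (logDerivCoeff (legendreChar hirr s) n / (Nat.card F : ℝ) ^ n)) * x ^ n))
          ((-1) ^ s.card * evenLogDeriv (legendreChar hirr s) x) := fun s _ =>
      (hasSum_evenLogDeriv (abs_legendreChar_le_one hirr s) hx).summable.hasSum.mul_left _
    rw [← (hasSum_sum h1).tsum_eq]
    refine tsum_congr fun n => ?_
    simp only [a]
    rw [← sum_neg_one_pow_card_mul_logDerivCoeff hirr, Finset.sum_div, Finset.mul_sum,
      Finset.sum_mul]
    exact Finset.sum_congr rfl fun s _ => by ring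
  have hB : ∀ s : Finset ι, ∃ B : ℝ, s.Nonempty →
      ∀ᶠ x in 𝓝[<] (1 : ℝ), |evenLogDeriv (legendreChar hirr s) x| ≤ B := by
    intro s
    by_cases hs : s.Nonempty
    · obtain ⟨B, hB⟩ := eventually_abs_evenLogDeriv_le (abs_legendreChar_le_one hirr s)
        fun n hn => lCoeff_legendreChar_eq_zero hF hinj hmon hirr hs hn
      exact ⟨B, fun _ => hB⟩
    · exact ⟨0, fun h => absurd h hs⟩
  choose B hB using hB
  have hall : ∀ᶠ x in 𝓝[<] (1 : ℝ), ∀ s ∈ (Finset.univ : Finset (Finset ι)).erase ∅,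
      |evenLogDeriv (legendreChar hirr s) x| ≤ B s :=
    (Filter.eventually_all_finset _).mpr fun s hs =>
      hB s (Finset.nonempty_iff_ne_empty.mpr (Finset.ne_of_mem_erase hs))
  have hunit : ∀ᶠ x in 𝓝[<] (1 : ℝ), x ∈ Set.Ioo (0 : ℝ) 1 := Ioo_mem_nhdsLT zero_lt_one
  obtain ⟨x, hx, hx1, hx2⟩ := (hall.and (hunit.and
    ((tendsto_evenLogDeriv_one (F := F)).eventually_gt_atTop
      (∑' n, |a n| + ∑ s ∈ (Finset.univ : Finset (Finset ι)).erase ∅, B s)))).exists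
  have hxabs : |x| < 1 := abs_lt.mpr ⟨by linarith [hx1.1], hx1.2⟩
  have hle : ∑' n, a n * x ^ n ≤ ∑' n, |a n| := by
    have h1 : ∀ n, |a n * x ^ n| ≤ |a n| := fun n => by
      rw [abs_mul, abs_pow]
      exact mul_le_of_le_one_right (abs_nonneg _) (pow_le_one₀ (abs_nonneg _) hxabs.le)
    exact Summable.tsum_le_tsum (fun n => (le_abs_self _).trans (h1 n))
      (Summable.of_norm_bounded ha h1) ha
  -- isolate the trivial character, which is the only unbounded term
  rw [hsum x hxabs, ← Finset.add_sum_erase _ _ (Finset.mem_univ ∅), legendreChar_empty] at hle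
  have hrest : -∑ s ∈ (Finset.univ : Finset (Finset ι)).erase ∅, B s
      ≤ ∑ s ∈ (Finset.univ : Finset (Finset ι)).erase ∅,
        (-1) ^ s.card * evenLogDeriv (legendreChar hirr s) x := by
    rw [← Finset.sum_neg_distrib]
    refine Finset.sum_le_sum fun s hs => ?_
    refine (abs_le.mp ?_).1
    rw [abs_mul, abs_pow, abs_neg, abs_one, one_pow, one_mul]
    exact hx s hs
  simp only [Finset.card_empty, pow_zero, one_mul] at hle
  linarith

end LegendreChar

/-! ### Non-residues and the symbol of the product -/

theorem mainTheorem12 {F : Type*} [Field F] [Finite F] (hq : Odd (Nat.card F))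
    (l : ℕ) (hl : 2 ≤ l) (hl_even : Even l)
    (ϖ : Fin l → Polynomial F) (hϖ_inj : Function.Injective ϖ)
    (hϖ_monic : ∀ i, (ϖ i).Monic) (hϖ_irr : ∀ i, Irreducible (ϖ i)) :
    (∃ α : Polynomial F, α.Monic ∧ Irreducible α ∧ Even α.natDegree ∧
      ∀ i, polyLegendre α (ϖ i) = -1) ∧
    (∀ α : Polynomial F, α.Monic → Irreducible α → Even α.natDegree →
      (∀ i, polyLegendre α (ϖ i) = -1) →
      polyLegendre (∏ i, ϖ i) α = 1) := by
  have hF : ringChar F ≠ 2 := by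
    intro h
    have := Fintype.ofFinite F
    have h2 := FiniteField.even_card_of_char_two h
    rw [Nat.card_eq_fintype_card, Nat.odd_iff] at hq
    omega
  -- for even `deg α` reciprocity has no sign, so the symbol of the product is `(-1) ^ l`
  refine ⟨exists_irreducible_even_polyLegendre_eq_neg_one hF hϖ_inj hϖ_monic hϖ_irr, ?_⟩
  intro α hα hirr heven h
  rw [polyLegendre_prod hirr, Finset.prod_congr rfl fun i _ =>
    ((polyLegendre_comm_of_even hF hα hirr (hϖ_monic i) (hϖ_irr i) heven).symm.trans (h i)),
    Finset.prod_const, Finset.card_univ, Fintype.card_fin, hl_even.neg_one_pow]
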